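/- Let $k \le n$ be positive integers. Let $I_{n,k} \subseteq \mathbb{Q}[x_1,\dots,x_n]$ be the homogeneous ideal generated by $x_1^k, \dots, x_n^k$ and by the elementary symmetric polynomials $e_n, e_{n-1}, \dots, e_{n-k+1}$ in $x_1, \dots, x_n$, and let $R_{n,k} := \mathbb{Q}[x_1,\dots,x_n]/I_{n,k}$, graded by degree, with Hilbert series $\mathrm{Hilb}(R_{n,k};q) := \sum_{d \ge 0} \dim_{\mathbb{Q}}\big((R_{n,k})_d\big)\, q^d$. Let $\mathcal{OP}_{n,k}$ be the set of ordered set partitions $\sigma = (B_1 \mid \cdots \mid B_k)$ of $[n] = \{1,\dots,n\}$ into $k$ nonempty blocks. Let $\mathrm{inv}(\sigma)$ be the number of pairs $i < j$ in $[n]$ such that, for some $\ell < m$, the letter $i$ is the minimum of $B_m$ and $j \in B_\ell$; and let $\mathrm{coinv}(\sigma) := \max\{\mathrm{inv}(\sigma') : \sigma' \in \mathcal{OP}_{n,k}\} - \mathrm{inv}(\sigma)$. Let $[m]_q := 1 + q + \cdots + q^{m-1}$ and $[k]!_q := [k]_q [k-1]_q \cdots [1]_q$. Let the $q$-Stirling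 numbers be defined by $\mathrm{Stir}_q(0,0) = 1$, $\mathrm{Stir}_q(m,0) = \mathrm{Stir}_q(0,m) = 0$ for $m \ge 1$, and $\mathrm{Stir}_q(m,j) = \mathrm{Stir}_q(m-1,j-1) + [j]_q \cdot \mathrm{Stir}_q(m-1,j)$ for $m, j \ge 1$. Let $\mathrm{Stir}(n,k)$ be the Stirling number of the second kind, the number of set partitions of $[n]$ into $k$ nonempty blocks. For a polynomial $f(q)$ of degree $D$, let $\mathrm{rev}_q(f)(q) := q^{D} f(1/q)$. Then $$\mathrm{Hilb}(R_{n,k};q) = \sum_{\sigma \in \mathcal{OP}_{n,k}} q^{\mathrm{coinv}(\sigma)} = \mathrm{rev}_q\big([k]!_q \cdot \mathrm{Stir}_q(n,k)\big).$$ In particular, $R_{n,k}$ is finite-dimensional over $\mathbb{Q}$ and $$\dim_{\mathbb{Q}}(R_{n,k}) = |\mathcal{OP}_{n,k}| = k! \cdot \mathrm{Stir}(n,k).$$ -/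

import Mathlib

namespace GenCoinv

/-! ### Ordered set partitions and the statistic `coinv` -/

/-- Ordered set partitions `(B 0 | B 1 | ⋯ | B (k-1))` of an `n`-element set of letters into `k`
nonempty blocks. The letters `1 < 2 < ⋯ < n` are represented by `Fin n` with its order. -/
def OrderedSetPartition (n k : ℕ) : Type :=
  {B : Fin k → Finset (Fin n) //
    (∀ m, (B m).Nonempty) ∧ (∀ l m, l ≠ m → Disjoint (B l) (B m)) ∧ ∀ a, ∃ m, a ∈ B m}

instance (n k : ℕ) : Fintype (OrderedSetPartition n k) :=
  inferInstanceAs (Fintype {B : Fin k → Finset (Fin n) //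
    (∀ m, (B m).Nonempty) ∧ (∀ l m, l ≠ m → Disjoint (B l) (B m)) ∧ ∀ a, ∃ m, a ∈ B m})

namespace OrderedSetPartition

/-- `m`-th block, counted from the left starting with `0`. -/
def block {n k : ℕ} (σ : OrderedSetPartition n k) (m : Fin k) : Finset (Fin n) := σ.1 m

/-- The pair of letters `(i, j)` is an inversion of `σ`: one has `i < j`, the letter `i` is minimal
in its block, and the block of `j` is strictly to the left of the block of `i`. -/
def IsInversion {n k : ℕ} (σ : OrderedSetPartition n k) (i j : Fin n) : Prop :=
  i < j ∧ ∃ l m : Fin k, l < m ∧ (i ∈ σ.block m ∧ ∀ a ∈ σ.block m, i ≤ a) ∧ j ∈ σ.block l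

instance {n k : ℕ} (σ : OrderedSetPartition n k) (i j : Fin n) : Decidable (σ.IsInversion i j) :=
  inferInstanceAs (Decidable (_ ∧ _))

/-- The number of inversions. -/
def inv {n k : ℕ} (σ : OrderedSetPartition n k) : ℕ :=
  (Finset.univ.filter fun p : Fin n × Fin n => σ.IsInversion p.1 p.2).card

/-- The maximum of `inv` over all ordered set partitions of size `n` with `k` blocks. -/
def maxInv (n k : ℕ) : ℕ := Finset.univ.sup fun σ : OrderedSetPartition n k => σ.inv

theorem inv_le_maxInv {n k : ℕ} (σ : OrderedSetPartition n k) : σ.inv ≤ maxInv n k :=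
  Finset.le_sup (f := fun τ : OrderedSetPartition n k => τ.inv) (Finset.mem_univ σ)

/-- The complementary statistic; the subtraction never truncates, by `inv_le_maxInv`. -/
def coinv {n k : ℕ} (σ : OrderedSetPartition n k) : ℕ := maxInv n k - σ.inv

end OrderedSetPartition

noncomputable section

/-- The generating function of `coinv` on ordered set partitions of size `n` with `k` blocks. -/
def coinvGenFun (n k : ℕ) : Polynomial ℤ :=
  ∑ σ : OrderedSetPartition n k, Polynomial.X ^ σ.coinv

/-! ### `q`-analogs -/

/-- `[n]_q = 1 + q + ⋯ + q ^ (n - 1)`. -/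
def qNumber (n : ℕ) : Polynomial ℤ := ∑ i ∈ Finset.range n, Polynomial.X ^ i

/-- `[n]!_q = [n]_q [n - 1]_q ⋯ [1]_q`. -/
def qFactorial (n : ℕ) : Polynomial ℤ := ∏ i ∈ Finset.Icc 1 n, qNumber i

/-- The `q`-Stirling numbers of the second kind, given by
`Stir_q(n, k) = Stir_q(n - 1, k - 1) + [k]_q * Stir_q(n - 1, k)`, where
`Stir_q(0, 0) = 1` and all other values with `n = 0` or `k = 0` vanish. -/
def qStirling : ℕ → ℕ → Polynomial ℤ
  | 0, 0 => 1
  | 0, _ + 1 => 0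
  | _ + 1, 0 => 0
  | n + 1, k + 1 => qStirling n k + qNumber (k + 1) * qStirling n (k + 1)

/-- The values for `n = 1`, which together with the recursion determine `Stir_q(n, k)` for all
positive `n` and `k`. -/
theorem qStirling_one (k : ℕ) (hk : 1 ≤ k) : qStirling 1 k = if k = 1 then 1 else 0 := by
  obtain ⟨j, rfl⟩ := Nat.exists_eq_add_of_le' hk
  cases j <;> simp [qStirling]

/-! ### The ideal, the quotient ring and its Hilbert series -/

/-- The ideal of `ℚ[x₁, …, xₙ]` generated by `x₁ ^ k, …, xₙ ^ k` and by the elementary symmetric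
polynomials `e_d(x₁, …, xₙ)` with `n - k + 1 ≤ d ≤ n`. It is used for `1 ≤ k ≤ n` only. -/
def idealI (n k : ℕ) : Ideal (MvPolynomial (Fin n) ℚ) :=
  Ideal.span (Set.range (fun i : Fin n => (MvPolynomial.X i : MvPolynomial (Fin n) ℚ) ^ k) ∪
    (fun d : ℕ => MvPolynomial.esymm (Fin n) ℚ d) '' Set.Icc (n - k + 1) n)

/-- The quotient ring `ℚ[x₁, …, xₙ] / I_{n,k}`. -/
abbrev ringR (n k : ℕ) : Type := MvPolynomial (Fin n) ℚ ⧸ idealI n k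

/-- The degree `d` piece of the quotient ring: the classes of the homogeneous polynomials of
degree `d`. -/
def gradedPiece (n k d : ℕ) : Submodule ℚ (ringR n k) :=
  (MvPolynomial.homogeneousSubmodule (Fin n) ℚ d).map
    (Ideal.Quotient.mkₐ ℚ (idealI n k)).toLinearMap

section Grading

attribute [local instance] MvPolynomial.gradedAlgebra

theorem idealI_isHomogeneous (n k : ℕ) :
    (idealI n k).IsHomogeneous (MvPolynomial.homogeneousSubmodule (Fin n) ℚ) := by
  refine Ideal.homogeneous_span _ _ ?_
  rintro _ (⟨i, rfl⟩ | ⟨d, -, rfl⟩)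
  · exact ⟨k, MvPolynomial.isHomogeneous_X_pow i k⟩
  · refine ⟨d, MvPolynomial.IsHomogeneous.sum _ _ _ fun t ht => ?_⟩
    have h := MvPolynomial.IsHomogeneous.prod t
      (fun i : Fin n => (MvPolynomial.X i : MvPolynomial (Fin n) ℚ)) (fun _ => 1)
      fun i _ => MvPolynomial.isHomogeneous_X ℚ i
    simpa [(Finset.mem_powersetCard.mp ht).2] using h

end Grading

/-- The pieces do form a grading of the quotient ring. -/
theorem gradedPiece_isInternal (n k : ℕ) : DirectSum.IsInternal (gradedPiece n k) := by
  refine DirectSum.isInternal_submodule_of_iSupIndep_of_iSup_eq_top ?_ ?_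
  · rw [iSupIndep_iff_finsetSum_eq_zero_imp_eq_zero]
    intro s v hv hs d hd
    have hv' : ∀ i, ∃ p : MvPolynomial (Fin n) ℚ, i ∈ s →
        p.IsHomogeneous i ∧ Ideal.Quotient.mk (idealI n k) p = v i := by
      intro i
      by_cases hi : i ∈ s
      · obtain ⟨p, hp, hpv⟩ := hv i hi
        exact ⟨p, fun _ => ⟨hp, hpv⟩⟩
      · exact ⟨0, fun h => absurd h hi⟩
    choose p hp using hv'
    have hmem : ∑ i ∈ s, p i ∈ idealI n k := by
      rw [← Ideal.Quotient.eq_zero_iff_mem, map_sum, ← hs]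
      exact Finset.sum_congr rfl fun i hi => (hp i hi).2
    have hcomp := (MvPolynomial.mem_iff_homogeneousComponent_mem
      (idealI_isHomogeneous n k) _).mp hmem d
    have hsum : MvPolynomial.homogeneousComponent d (∑ i ∈ s, p i) = p d := by
      rw [map_sum, Finset.sum_eq_single_of_mem d hd]
      · rw [MvPolynomial.homogeneousComponent_of_mem (hp d hd).1, if_pos rfl]
      · intro i hi hid
        rw [MvPolynomial.homogeneousComponent_of_mem (hp i hi).1, if_neg hid.symm]
    rw [hsum] at hcomp
    rw [← (hp d hd).2]
    exact Ideal.Quotient.eq_zero_iff_mem.mpr hcomp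
  · rw [eq_top_iff]
    rintro x -
    obtain ⟨p, rfl⟩ := Ideal.Quotient.mk_surjective x
    rw [← MvPolynomial.sum_homogeneousComponent p, map_sum]
    exact Submodule.sum_mem _ fun d _ => Submodule.mem_iSup_of_mem d
      ⟨_, MvPolynomial.homogeneousComponent_mem d p, rfl⟩

/-- Each graded piece is finite-dimensional. -/
theorem gradedPiece_finite (n k d : ℕ) : Module.Finite ℚ (gradedPiece n k d) :=
  Module.Finite.iff_fg.mpr ((MvPolynomial.homogeneousSubmodule_fg (Fin n) ℚ d).map _)

/-- The Hilbert series `∑ d, dim (R_{n,k})_d * q ^ d`. -/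
def hilbertSeries (n k : ℕ) : PowerSeries ℤ :=
  PowerSeries.mk fun d => (Module.finrank ℚ (gradedPiece n k d) : ℤ)

end

end GenCoinv

/-! The ring is squeezed between an explicit spanning set of monomials and the functions on an
explicit finite set of points, and both have the size of the set of ordered set partitions.

Upper bound: filter by powers of `x₀`. For the larger family `idealJ n k s`, the layer of `x₀ ^ i`
is controlled by the ideal in one variable less, with parameter `s - 1` if `i < s` and `s`
otherwise. Following this recursion down to no variables produces the monomials of `std`, which span
modulo the ideal (`idealJ_sup_span_std`).

Lower bound: view surjections `Fin n → Fin k` as points of `ℚⁿ`. Every generator of the ideal is the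
leading form of a polynomial vanishing at all these points. Hence monomials spanning modulo the
homogeneous ideal also span the functions on the points, and there are at least as many of them as
surjections (`card_surj_le_card`).

Counting: the degree generating function of `std` satisfies the recursion of the reversed `[k]!_q
Stir_q(n, k)` (`stdGenFun_self_eq_reverse`), and removing the largest letter shows that `[k]!_q
Stir_q(n, k)` enumerates ordered set partitions by `inv` (`invGenFun_eq_qSurj`). At `q = 1` the two
bounds agree, so the standard monomials form a basis, and sorting them by degree gives the Hilbert
series. -/

namespace GenCoinv

/-! ### Standard monomials span the quotient. -/

section

open MvPolynomial

/-- The ideal generated by `x₁ ^ k, …, xₙ ^ k` and the elementary symmetric polynomials `e_j` with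
`n - s < j`. -/
noncomputable def idealJ (n k s : ℕ) : Ideal (MvPolynomial (Fin n) ℚ) :=
  Ideal.span (Set.range (fun i : Fin n => (X i : MvPolynomial (Fin n) ℚ) ^ k) ∪
    {p | ∃ j, n < j + s ∧ p = esymm (Fin n) ℚ j})

theorem X_pow_mem_idealJ {n k s : ℕ} (i : Fin n) :
    (X i : MvPolynomial (Fin n) ℚ) ^ k ∈ idealJ n k s :=
  Ideal.subset_span (Or.inl ⟨i, rfl⟩)

theorem esymm_mem_idealJ {n k s j : ℕ} (h : n < j + s) :
    esymm (Fin n) ℚ j ∈ idealJ n k s :=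
  Ideal.subset_span (Or.inr ⟨j, h, rfl⟩)

theorem esymm_eq_zero_of_lt {n j : ℕ} (h : n < j) : esymm (Fin n) ℚ j = 0 := by
  rw [esymm, Finset.powersetCard_eq_empty.mpr (by simpa using h), Finset.sum_empty]

theorem idealJ_self {n k : ℕ} (hkn : k ≤ n) : idealJ n k k = idealI n k := by
  apply le_antisymm
  · refine Ideal.span_le.mpr ?_
    rintro _ (⟨i, rfl⟩ | ⟨j, hj, rfl⟩)
    · exact Ideal.subset_span (Or.inl ⟨i, rfl⟩)
    · rcases le_or_gt j n with h | h
      · exact Ideal.subset_span (Or.inr ⟨j, ⟨by omega, h⟩, rfl⟩)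
      · rw [esymm_eq_zero_of_lt h]
        exact Submodule.zero_mem _
  · refine Ideal.span_le.mpr ?_
    rintro _ (⟨i, rfl⟩ | ⟨j, hj, rfl⟩)
    · exact X_pow_mem_idealJ i
    · exact esymm_mem_idealJ (by have := hj.1; omega)

/-- `e_{j+1}(x₀, x') = e_{j+1}(x') + x₀ e_j(x')`. -/
theorem esymm_succ (n j : ℕ) : esymm (Fin (n + 1)) ℚ (j + 1) =
    rename Fin.succ (esymm (Fin n) ℚ (j + 1)) + X 0 * rename Fin.succ (esymm (Fin n) ℚ j) := by
  have h : ∀ i, rename Fin.succ (esymm (Fin n) ℚ i) =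
      ((Finset.univ : Finset (Fin n)).val.map
        fun a => (X a.succ : MvPolynomial (Fin (n + 1)) ℚ)).esymm i := by
    intro i
    rw [← aeval_esymm_eq_multiset_esymm (Fin n) ℚ]
    congr 1
    exact algHom_ext fun a => by simp
  have h2 : (Finset.univ : Finset (Fin (n + 1))).val.map
      (X : Fin (n + 1) → MvPolynomial (Fin (n + 1)) ℚ) =
      X 0 ::ₘ (Finset.univ : Finset (Fin n)).val.map fun a => X a.succ := by
    rw [Fin.univ_succ]
    simp only [Finset.cons_val, Finset.map_val, Multiset.map_cons, Multiset.map_map]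
    rfl
  rw [h, h, esymm_eq_multiset_esymm, h2, Multiset.esymm, Multiset.powersetCard_cons,
    Multiset.map_add, Multiset.sum_add, Multiset.map_map]
  simp only [Function.comp_def, Multiset.prod_cons, Multiset.sum_map_mul_left]
  rfl

/-- By `esymm_succ`, `x₀ e_j(x') = e_{j+1}(x) - e_{j+1}(x')`. Starting from `e_{n+1}(x') = 0`, each
factor `x₀` lowers the index by one, and the `e_{j+1}(x)` subtracted on the way are generators as
long as `m ≤ s`. -/
theorem X_pow_mul_rename_esymm_mem {n k s m : ℕ} (hms : m ≤ s) (hmn : m ≤ n + 1) :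
    (X 0 : MvPolynomial (Fin (n + 1)) ℚ) ^ m * rename Fin.succ (esymm (Fin n) ℚ (n + 1 - m)) ∈
      idealJ (n + 1) k s := by
  induction m with
  | zero => rw [esymm_eq_zero_of_lt (by omega)]; simp
  | succ m ih =>
    obtain ⟨j, hj⟩ : ∃ j, n + 1 - m = j + 1 := ⟨n - m, by omega⟩
    have h1 := ih (by omega) (by omega)
    have h2 : esymm (Fin (n + 1)) ℚ (j + 1) ∈ idealJ (n + 1) k s := esymm_mem_idealJ (by omega)
    have h3 : n + 1 - (m + 1) = j := by omega
    rw [hj] at h1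
    rw [h3]
    convert Ideal.sub_mem _ (Ideal.mul_mem_left _ (X 0 ^ m) h2) h1 using 1
    rw [esymm_succ]
    ring

/-- Setting `x₀ = 0` turns `e_j(x)` into `e_j(x')`. -/
theorem rename_esymm_mem {n k s j : ℕ} (h : n + 1 < j + s) :
    rename Fin.succ (esymm (Fin n) ℚ j) ∈ idealJ (n + 1) k s ⊔ Ideal.span {X 0} := by
  rcases j with _ | j
  · have h2 : esymm (Fin (n + 1)) ℚ 0 ∈ idealJ (n + 1) k s := esymm_mem_idealJ h
    exact Ideal.mem_sup_left (by simpa using h2)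
  · have h2 : esymm (Fin (n + 1)) ℚ (j + 1) ∈ idealJ (n + 1) k s := esymm_mem_idealJ h
    rw [esymm_succ] at h2
    refine Submodule.mem_sup.mpr ⟨_, h2, - (X 0 * rename Fin.succ (esymm (Fin n) ℚ j)), ?_, by ring⟩
    exact neg_mem (Ideal.mul_mem_right _ _ (Ideal.mem_span_singleton_self _))

theorem X_pow_mul_mem_sup {n : ℕ} {I : Ideal (MvPolynomial (Fin (n + 1)) ℚ)} (i : ℕ)
    {p : MvPolynomial (Fin (n + 1)) ℚ} (hp : p ∈ I ⊔ Ideal.span {X 0}) :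
    X 0 ^ i * p ∈ I ⊔ Ideal.span {X 0 ^ (i + 1)} := by
  obtain ⟨a, ha, b, hb, rfl⟩ := Submodule.mem_sup.mp hp
  obtain ⟨c, rfl⟩ := Ideal.mem_span_singleton'.mp hb
  refine Submodule.mem_sup.mpr ⟨X 0 ^ i * a, Ideal.mul_mem_left _ _ ha, c * X 0 ^ (i + 1),
    Ideal.mul_mem_left _ _ (Ideal.mem_span_singleton_self _), by ring⟩

/-- Multiplication by `x₀ ^ i` maps the ideal in one variable less into the ideal, up to
higher powers of `x₀`. -/
theorem X_pow_mul_rename_mem {n k s i : ℕ} {g : MvPolynomial (Fin n) ℚ}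
    (hg : g ∈ idealJ n k (if i < s then s - 1 else s)) :
    (X 0 : MvPolynomial (Fin (n + 1)) ℚ) ^ i * rename Fin.succ g ∈
      idealJ (n + 1) k s ⊔ Ideal.span {X 0 ^ (i + 1)} := by
  rw [idealJ] at hg
  induction hg using Submodule.span_induction with
  | zero => simp
  | add x y _ _ hx hy => rw [map_add, mul_add]; exact Ideal.add_mem _ hx hy
  | smul a x _ hx =>
    rw [smul_eq_mul, map_mul, mul_left_comm]
    exact Ideal.mul_mem_left _ _ hx
  | mem x hx =>
    rcases hx with ⟨a, rfl⟩ | ⟨j, hj, rfl⟩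
    · rw [map_pow, rename_X]
      exact Ideal.mul_mem_left _ _ (Ideal.mem_sup_left (X_pow_mem_idealJ _))
    -- Generators with `j > n + 1 - s` come from `e_j(x)` modulo `x₀`; if `i < s` there are no
    -- others. If `i ≥ s`, the one extra generator has `j = n + 1 - s`, and `x₀ ^ s` already carries
    -- it into the ideal.
    · by_cases hjs : n + 1 < j + s
      · exact X_pow_mul_mem_sup i (rename_esymm_mem hjs)
      · split_ifs at hj with his
        · omega
        · have h := X_pow_mul_rename_esymm_mem (n := n) (k := k) (s := s) (m := s) le_rfl (by omega)
          rw [show n + 1 - s = j by omega] at h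
          have hi : (X 0 : MvPolynomial (Fin (n + 1)) ℚ) ^ i = X 0 ^ (i - s) * X 0 ^ s := by
            rw [← pow_add, Nat.sub_add_cancel (not_lt.mp his)]
          rw [hi, mul_assoc]
          exact Ideal.mem_sup_left (Ideal.mul_mem_left _ _ h)

/-- The exponent vectors of the standard monomials. -/
def std (k : ℕ) : (n s : ℕ) → Finset (Fin n → ℕ)
  | 0, 0 => Finset.univ
  | 0, _ + 1 => ∅
  | n + 1, s => (Finset.range k).biUnion fun i =>
      (std k n (if i < s then s - 1 else s)).image (Fin.cons (α := fun _ => ℕ) i)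

/-- The monomial with a given exponent vector. -/
noncomputable def mono {n : ℕ} (a : Fin n → ℕ) : MvPolynomial (Fin n) ℚ := ∏ i, X i ^ a i

theorem mono_cons {n : ℕ} (i : ℕ) (a : Fin n → ℕ) :
    mono (Fin.cons (α := fun _ => ℕ) i a) = X 0 ^ i * rename Fin.succ (mono a) := by
  simp [mono, Fin.prod_univ_succ]

theorem mono_isHomogeneous {n : ℕ} (a : Fin n → ℕ) : (mono a).IsHomogeneous (∑ i, a i) :=
  IsHomogeneous.prod _ _ _ fun i _ => isHomogeneous_X_pow i (a i)

theorem exists_eq_rename_add_X_mul {n : ℕ} (p : MvPolynomial (Fin (n + 1)) ℚ) :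
    ∃ q r, p = rename Fin.succ q + X 0 * r := by
  induction p using MvPolynomial.induction_on with
  | C a => exact ⟨C a, 0, by simp⟩
  | add p p' h h' =>
    obtain ⟨q, r, rfl⟩ := h
    obtain ⟨q', r', rfl⟩ := h'
    exact ⟨q + q', r + r', by rw [map_add]; ring⟩
  | mul_X p i h =>
    obtain ⟨q, r, rfl⟩ := h
    refine Fin.cases ⟨0, rename Fin.succ q + X 0 * r, by simp; ring⟩ (fun j => ?_) i
    exact ⟨q * X j, r * X j.succ, by rw [map_mul, rename_X]; ring⟩

/-- The standard monomials span the quotient. -/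
theorem idealJ_sup_span_std (k n s : ℕ) :
    (idealJ n k s).restrictScalars ℚ ⊔ Submodule.span ℚ (mono '' (std k n s : Set (Fin n → ℕ))) =
      ⊤ := by
  induction n generalizing s with
  | zero =>
    rw [eq_top_iff]
    rintro p -
    rcases s with _ | s
    · obtain ⟨c, rfl⟩ := C_surjective (Fin 0) p
      refine Submodule.mem_sup_right ?_
      rw [← mul_one (C c), ← smul_eq_C_mul]
      refine Submodule.smul_mem _ _ (Submodule.subset_span ⟨0, by rw [std]; exact Finset.mem_coe.mpr (Finset.mem_univ _), by simp [mono]⟩)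
    -- For `s ≥ 1` the generators include `e_0 = 1`, which matches the empty set in `std`.
    · refine Submodule.mem_sup_left ?_
      have h : esymm (Fin 0) ℚ 0 ∈ idealJ 0 k (s + 1) := esymm_mem_idealJ (by omega)
      rw [esymm_zero] at h
      simpa using Ideal.mul_mem_left _ p h
  | succ n ih =>
    set W := (idealJ (n + 1) k s).restrictScalars ℚ ⊔
      Submodule.span ℚ (mono '' (std k (n + 1) s : Set (Fin (n + 1) → ℕ))) with hW
    have hI : ∀ p ∈ idealJ (n + 1) k s, p ∈ W := fun p hp => Submodule.mem_sup_left hp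
    -- Descending induction on the power of `x₀`, from `x₀ ^ k` in the ideal. All errors are
    -- multiples of `x₀ ^ (i + 1)`, so only the part of `p` free of `x₀` matters, and it is reduced
    -- by the hypothesis in one variable less.
    have key : ∀ i, i ≤ k → ∀ p : MvPolynomial (Fin (n + 1)) ℚ, X 0 ^ i * p ∈ W := by
      intro i hi
      induction hi using Nat.decreasingInduction with
      | self => exact fun p => hI _ (Ideal.mul_mem_right _ _ (X_pow_mem_idealJ 0))
      | of_succ i hi hnext =>
        intro p
        obtain ⟨q, r, rfl⟩ := exists_eq_rename_add_X_mul p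
        rw [mul_add, ← mul_assoc, ← pow_succ]
        refine add_mem ?_ (hnext r)
        have hq : q ∈ (⊤ : Submodule ℚ (MvPolynomial (Fin n) ℚ)) := trivial
        rw [← ih (if i < s then s - 1 else s)] at hq
        obtain ⟨g, hg, b, hb, rfl⟩ := Submodule.mem_sup.mp hq
        rw [map_add, mul_add]
        refine add_mem ?_ ?_
        · obtain ⟨u, hu, v, hv, huv⟩ := Submodule.mem_sup.mp (X_pow_mul_rename_mem hg)
          rw [← huv]
          obtain ⟨c, rfl⟩ := Ideal.mem_span_singleton'.mp hv
          rw [mul_comm c]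
          exact add_mem (hI u hu) (hnext c)
        · clear hq
          induction hb using Submodule.span_induction with
          | zero => simp
          | add x y _ _ hx hy => rw [map_add, mul_add]; exact add_mem hx hy
          | smul c x _ hx => rw [map_smul, mul_smul_comm]; exact Submodule.smul_mem _ _ hx
          | mem x hx =>
            obtain ⟨a, ha, rfl⟩ := hx
            rw [← mono_cons]
            refine Submodule.mem_sup_right (Submodule.subset_span ⟨_, ?_, rfl⟩)
            simp only [std, Finset.mem_coe, Finset.mem_biUnion, Finset.mem_range, Finset.mem_image]
            exact ⟨i, hi, a, ha, rfl⟩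
    rw [eq_top_iff]
    rintro p -
    simpa using key 0 (Nat.zero_le _) p

/-! ### Lower bound from the points given by surjections. -/

/-- The polynomials of degree less than `d`. -/
noncomputable def low (n d : ℕ) : Submodule ℚ (MvPolynomial (Fin n) ℚ) :=
  Submodule.span ℚ {p | ∃ e < d, p.IsHomogeneous e}

theorem mem_low {n d e : ℕ} {p : MvPolynomial (Fin n) ℚ} (hp : p.IsHomogeneous e) (h : e < d) :
    p ∈ low n d := Submodule.subset_span ⟨e, h, hp⟩

theorem mul_mem_low {n d m : ℕ} {a p : MvPolynomial (Fin n) ℚ} (ha : a.IsHomogeneous m)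
    (hp : p ∈ low n d) : a * p ∈ low n (m + d) := by
  rw [low] at hp
  induction hp using Submodule.span_induction with
  | zero => simp
  | add x y _ _ hx hy => rw [mul_add]; exact add_mem hx hy
  | smul c x _ hx => rw [mul_smul_comm]; exact Submodule.smul_mem _ _ hx
  | mem x hx =>
    obtain ⟨e, he, hx⟩ := hx
    exact mem_low (ha.mul hx) (by omega)

theorem low_mono {n d d' : ℕ} (h : d ≤ d') : low n d ≤ low n d' :=
  Submodule.span_mono fun _ ⟨e, he, hp⟩ => ⟨e, by omega, hp⟩

/-- If every generator of an ideal agrees modulo `J` with a polynomial of lower degree, then so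
does every homogeneous component of an element of the ideal. -/
theorem homogeneousComponent_mem_low_sup {n : ℕ} {S : Set (MvPolynomial (Fin n) ℚ)}
    {J : Ideal (MvPolynomial (Fin n) ℚ)}
    (hS : ∀ s ∈ S, ∃ m, s.IsHomogeneous m ∧ ∃ l ∈ low n m, s - l ∈ J)
    {g : MvPolynomial (Fin n) ℚ} (hg : g ∈ Ideal.span S) (d : ℕ) :
    homogeneousComponent d g ∈ low n d ⊔ J.restrictScalars ℚ := by
  -- The multiplier `a` makes the claim stable under the ideal action, as components do not commute
  -- with multiplication by inhomogeneous polynomials.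
  suffices h : ∀ a, homogeneousComponent d (a * g) ∈ low n d ⊔ J.restrictScalars ℚ by
    simpa using h 1
  induction hg using Submodule.span_induction with
  | zero => simp
  | add x y _ _ hx hy => intro a; rw [mul_add, map_add]; exact add_mem (hx a) (hy a)
  | smul c x _ hx => intro a; rw [smul_eq_mul, ← mul_assoc]; exact hx _
  | mem s hs =>
    intro a
    obtain ⟨m, hm, l, hl, hsl⟩ := hS s hs
    rw [← sum_homogeneousComponent a, Finset.sum_mul, map_sum]
    refine Submodule.sum_mem _ fun i _ => ?_
    have ha := homogeneousComponent_isHomogeneous i a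
    rw [homogeneousComponent_of_mem (ha.mul hm)]
    split_ifs with hd
    · subst hd
      refine Submodule.mem_sup.mpr ⟨_, mul_mem_low ha hl, homogeneousComponent i a * (s - l),
        Ideal.mul_mem_left _ _ hsl, by ring⟩
    · exact Submodule.zero_mem _

/-- Surjective maps, viewed as points of affine space. -/
abbrev Surj (n k : ℕ) : Type := {f : Fin n → Fin k // Function.Surjective f}

/-- The restriction of polynomials to the points given by the surjections. -/
noncomputable def evalSurj (n k : ℕ) : MvPolynomial (Fin n) ℚ →ₐ[ℚ] (Surj n k → ℚ) :=
  aeval fun i f => ((f.1 i : ℕ) : ℚ)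

theorem evalSurj_apply {n k : ℕ} (p : MvPolynomial (Fin n) ℚ) (f : Surj n k) :
    evalSurj n k p f = aeval (fun i => ((f.1 i : ℕ) : ℚ)) p := by
  have h : (Pi.evalAlgHom ℚ (fun _ : Surj n k => ℚ) f).comp (evalSurj n k) =
      aeval (fun i => ((f.1 i : ℕ) : ℚ)) := algHom_ext fun i => by simp [evalSurj]
  exact DFunLike.congr_fun h p

/-- Lagrange interpolation: `L f` vanishes at every surjection except `f`. -/
theorem evalSurj_surjective (n k : ℕ) : Function.Surjective (evalSurj n k) := by
  intro φ
  let L : Surj n k → MvPolynomial (Fin n) ℚ := fun f =>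
    ∏ i, ∏ c ∈ Finset.univ.erase (f.1 i), (X i - C ((c : ℕ) : ℚ))
  have hne : ∀ f, evalSurj n k (L f) f ≠ 0 := by
    intro f
    simp only [L, evalSurj_apply, map_prod, map_sub, aeval_X, aeval_C]
    refine Finset.prod_ne_zero_iff.mpr fun i _ => Finset.prod_ne_zero_iff.mpr fun c hc => ?_
    rw [sub_ne_zero]
    intro h
    exact (Finset.mem_erase.mp hc).1 (Fin.ext (by simpa using h.symm))
  have hz : ∀ f g, g ≠ f → evalSurj n k (L f) g = 0 := by
    intro f g hgf
    obtain ⟨i, hi⟩ := Function.ne_iff.mp fun h => hgf (Subtype.ext h)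
    simp only [L, evalSurj_apply, map_prod, map_sub, aeval_X, aeval_C]
    refine Finset.prod_eq_zero (Finset.mem_univ i)
      (Finset.prod_eq_zero (Finset.mem_erase.mpr ⟨hi, Finset.mem_univ _⟩) ?_)
    simp
  refine ⟨∑ f, (φ f / evalSurj n k (L f) f) • L f, ?_⟩
  ext g
  rw [map_sum, Finset.sum_apply, Finset.sum_eq_single g]
  · rw [map_smul, Pi.smul_apply, smul_eq_mul, div_mul_cancel₀ _ (hne g)]
  · intro f _ hf
    rw [map_smul, Pi.smul_apply, hz f g hf.symm, smul_zero]
  · simp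

theorem prod_X_sub_C_sub_X_pow_mem_low {n : ℕ} (i : Fin n) (s : Finset ℚ) :
    ∏ c ∈ s, (X i - C c) - X i ^ s.card ∈ low n s.card := by
  classical
  induction s using Finset.induction_on with
  | empty => simp
  | insert c s hc ih =>
    rw [Finset.prod_insert hc, Finset.card_insert_of_notMem hc]
    set P := ∏ c ∈ s, ((X i : MvPolynomial (Fin n) ℚ) - C c)
    have h1 := mul_mem_low (isHomogeneous_X ℚ i) ih
    have h2 : P ∈ low n (s.card + 1) := by
      rw [← sub_add_cancel P (X i ^ s.card)]
      exact add_mem (low_mono (Nat.le_succ _) ih)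
        (mem_low (isHomogeneous_X_pow i _) (Nat.lt_succ_self _))
    rw [add_comm 1] at h1
    convert sub_mem h1 (Submodule.smul_mem _ c h2) using 1
    rw [smul_eq_C_mul]
    ring

/-- The product of `x_i - c` over the `k` possible values `c` vanishes at all the points and has
leading form `x_i ^ k`. -/
theorem X_pow_sub_mem_ker (n k : ℕ) (i : Fin n) :
    ∃ l ∈ low n k, X i ^ k - l ∈ RingHom.ker (evalSurj n k) := by
  classical
  have hinj : Function.Injective fun c : Fin k => ((c : ℕ) : ℚ) := fun a b h =>
    Fin.ext (by simpa using h)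
  have h := prod_X_sub_C_sub_X_pow_mem_low i (Finset.univ.image fun c : Fin k => ((c : ℕ) : ℚ))
  rw [Finset.card_image_of_injective _ hinj, Finset.card_univ, Fintype.card_fin,
    Finset.prod_image fun a _ b _ => fun h => hinj h] at h
  refine ⟨_, neg_mem h, ?_⟩
  rw [neg_sub, sub_sub_cancel, RingHom.mem_ker]
  ext f
  rw [evalSurj_apply, map_prod]
  exact Finset.prod_eq_zero (Finset.mem_univ (f.1 i)) (by simp)

theorem coeff_prod_one_add_C_mul_X {ι : Type*} (s : Finset ι) (x : ι → ℚ) (r : ℕ) :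
    PowerSeries.coeff r (∏ i ∈ s, (1 + PowerSeries.C (x i) * PowerSeries.X)) =
      ∑ t ∈ s.powersetCard r, ∏ i ∈ t, x i := by
  classical
  simp only [Finset.prod_one_add, Finset.prod_mul_distrib, Finset.prod_const, map_sum,
    ← map_prod, PowerSeries.coeff_C_mul, PowerSeries.coeff_X_pow]
  rw [Finset.powersetCard_eq_filter]
  rw [Finset.sum_filter]
  refine Finset.sum_congr rfl fun t _ => ?_
  simp [eq_comm]

/-- The power series `∏_c (1 + c T)⁻¹` over all values `c`. -/
noncomputable def invProd (k : ℕ) : PowerSeries ℚ :=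
  (∏ c : Fin k, (1 + PowerSeries.C ((c : ℕ) : ℚ) * PowerSeries.X))⁻¹

theorem constantCoeff_prod_one_add (k : ℕ) : PowerSeries.constantCoeff
    (∏ c : Fin k, (1 + PowerSeries.C ((c : ℕ) : ℚ) * PowerSeries.X)) = 1 := by
  simp [map_prod]

/-- A surjection takes each value `c`, so `∏_c (1 + c T)` divides `∏_i (1 + f(i) T)`. The quotient
is a product of `n - k` linear factors, so its coefficient at `T ^ r` vanishes for `r > n - k`. -/
theorem sum_coeff_invProd_mul_esymm {n k r : ℕ} (hr : n < r + k) (f : Surj n k) :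
    ∑ p ∈ Finset.HasAntidiagonal.antidiagonal r, PowerSeries.coeff p.2 (invProd k) *
      ∑ t ∈ Finset.univ.powersetCard p.1, ∏ i ∈ t, ((f.1 i : ℕ) : ℚ) = 0 := by
  classical
  obtain ⟨g, hg⟩ := f.2.hasRightInverse
  have hT : (Finset.univ.image g).card = k := by
    rw [Finset.card_image_of_injective _ hg.injective, Finset.card_univ, Fintype.card_fin]
  have hprod : (∏ i, (1 + PowerSeries.C ((f.1 i : ℕ) : ℚ) * PowerSeries.X)) * invProd k =
      ∏ i ∈ (Finset.univ.image g)ᶜ,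
        (1 + PowerSeries.C ((f.1 i : ℕ) : ℚ) * PowerSeries.X) := by
    rw [← Finset.prod_mul_prod_compl (Finset.univ.image g),
      Finset.prod_image fun a _ b _ => fun h => hg.injective h]
    simp only [hg _]
    rw [mul_right_comm, invProd, PowerSeries.mul_inv_cancel _ (by
      rw [constantCoeff_prod_one_add]; exact one_ne_zero), one_mul]
  have h := congrArg (PowerSeries.coeff r) hprod
  rw [PowerSeries.coeff_mul, coeff_prod_one_add_C_mul_X, Finset.powersetCard_eq_empty.mpr (by
    rw [Finset.card_compl, Fintype.card_fin, hT]
    have := Fintype.card_le_of_injective _ hg.injective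
    simp only [Fintype.card_fin] at this
    omega), Finset.sum_empty] at h
  rw [← h]
  refine Finset.sum_congr rfl fun p _ => ?_
  rw [coeff_prod_one_add_C_mul_X, mul_comm]

theorem esymm_isHomogeneous (n d : ℕ) : (esymm (Fin n) ℚ d).IsHomogeneous d := by
  refine IsHomogeneous.sum _ _ _ fun t ht => ?_
  have h := IsHomogeneous.prod t (fun i : Fin n => (X i : MvPolynomial (Fin n) ℚ)) (fun _ => 1)
    fun i _ => isHomogeneous_X ℚ i
  simpa [(Finset.mem_powersetCard.mp ht).2] using h

/-- The vanishing sum of `sum_coeff_invProd_mul_esymm` is a polynomial in the coordinates with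
leading form `e_r`, because `invProd` has constant term `1`. -/
theorem esymm_sub_mem_ker {n k r : ℕ} (hr : n < r + k) :
    ∃ l ∈ low n r, esymm (Fin n) ℚ r - l ∈ RingHom.ker (evalSurj n k) := by
  let P : MvPolynomial (Fin n) ℚ := ∑ p ∈ Finset.HasAntidiagonal.antidiagonal r,
    PowerSeries.coeff p.2 (invProd k) • esymm (Fin n) ℚ p.1
  refine ⟨esymm (Fin n) ℚ r - P, ?_, ?_⟩
  · have hmem : (r, 0) ∈ Finset.HasAntidiagonal.antidiagonal r := by simp
    have h1 : PowerSeries.coeff 0 (invProd k) = 1 := by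
      rw [PowerSeries.coeff_zero_eq_constantCoeff_apply, invProd, PowerSeries.constantCoeff_inv,
        constantCoeff_prod_one_add, inv_one]
    simp only [P]
    rw [← Finset.add_sum_erase _ _ hmem, h1, one_smul, sub_add_cancel_left]
    refine neg_mem (Submodule.sum_mem _ fun p hp => Submodule.smul_mem _ _
      (mem_low (esymm_isHomogeneous _ _) ?_))
    obtain ⟨hne, hp⟩ := Finset.mem_erase.mp hp
    rw [Finset.HasAntidiagonal.mem_antidiagonal] at hp
    by_contra hlt
    exact hne (Prod.ext (by simp; omega) (by simp; omega))
  · rw [sub_sub_cancel, RingHom.mem_ker]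
    ext f
    rw [evalSurj_apply, map_sum, Pi.zero_apply, ← sum_coeff_invProd_mul_esymm hr f]
    refine Finset.sum_congr rfl fun p _ => ?_
    rw [map_smul, smul_eq_mul, esymm]
    simp [map_sum, map_prod]

/-- Monomials that span the quotient ring are at least as many as there are surjections. -/
theorem card_surj_le_card {n k : ℕ} (T : Finset (Fin n → ℕ))
    (hT : (idealJ n k k).restrictScalars ℚ ⊔
      Submodule.span ℚ (mono '' (T : Set (Fin n → ℕ))) = ⊤) :
    Fintype.card (Surj n k) ≤ T.card := by
  classical
  set J := RingHom.ker (evalSurj n k) with hJ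
  set M := Submodule.span ℚ (mono '' (T : Set (Fin n → ℕ))) with hM
  -- A span of monomials is graded; this is where it matters that `T` consists of monomials.
  have hcomp : ∀ d, ∀ b ∈ M, homogeneousComponent d b ∈ M := by
    intro d b hb
    rw [hM] at hb
    induction hb using Submodule.span_induction with
    | zero => simp
    | add x y _ _ hx hy => rw [map_add]; exact add_mem hx hy
    | smul c x _ hx => rw [map_smul]; exact Submodule.smul_mem _ _ hx
    | mem x hx =>
      obtain ⟨a, ha, rfl⟩ := hx
      rw [homogeneousComponent_of_mem (mono_isHomogeneous a)]
      split_ifs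
      · exact Submodule.subset_span ⟨a, ha, rfl⟩
      · exact Submodule.zero_mem _
  have hgen : ∀ s ∈ Set.range (fun i : Fin n => (X i : MvPolynomial (Fin n) ℚ) ^ k) ∪
      {p | ∃ j, n < j + k ∧ p = esymm (Fin n) ℚ j},
      ∃ m, s.IsHomogeneous m ∧ ∃ l ∈ low n m, s - l ∈ J := by
    rintro _ (⟨i, rfl⟩ | ⟨j, hj, rfl⟩)
    · exact ⟨k, isHomogeneous_X_pow i k, X_pow_sub_mem_ker n k i⟩
    · exact ⟨j, esymm_isHomogeneous n j, esymm_sub_mem_ker hj⟩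
  have key : ∀ d, ∀ p : MvPolynomial (Fin n) ℚ, p.IsHomogeneous d →
      p ∈ M ⊔ J.restrictScalars ℚ := by
    intro d
    induction d using Nat.strong_induction_on with
    | _ d ih =>
      intro p hp
      have hlow : low n d ≤ M ⊔ J.restrictScalars ℚ :=
        Submodule.span_le.mpr fun q ⟨e, he, hq⟩ => ih e he q hq
      -- Take degree `d` components of `p = g + b`: that of `b` stays in `M`, that of `g` drops to
      -- lower degree modulo `J`, where induction applies.
      obtain ⟨g, hg, b, hb, hgb⟩ := Submodule.mem_sup.mp (hT.ge (Submodule.mem_top (x := p)))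
      have h : homogeneousComponent d p = p := by
        rw [homogeneousComponent_of_mem hp, if_pos rfl]
      rw [← h, ← hgb, map_add]
      refine add_mem (sup_le hlow le_sup_right ?_) (Submodule.mem_sup_left (hcomp d b hb))
      exact homogeneousComponent_mem_low_sup hgen hg d
  have htop : M ⊔ J.restrictScalars ℚ = ⊤ := by
    rw [eq_top_iff]
    rintro p -
    rw [← sum_homogeneousComponent p]
    exact Submodule.sum_mem _ fun d _ => key d _ (homogeneousComponent_isHomogeneous d p)
  have hspan : Submodule.span ℚ
      ((T.image fun a => evalSurj n k (mono a) : Finset (Surj n k → ℚ)) : Set (Surj n k → ℚ)) =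
        ⊤ := by
    rw [eq_top_iff]
    rintro φ -
    obtain ⟨p, rfl⟩ := evalSurj_surjective n k φ
    obtain ⟨b, hb, c, hc, rfl⟩ := Submodule.mem_sup.mp (htop.ge (Submodule.mem_top (x := p)))
    rw [map_add, (RingHom.mem_ker).mp hc, add_zero, Finset.coe_image]
    have := Submodule.mem_map_of_mem (f := (evalSurj n k).toLinearMap) hb
    rw [hM, Submodule.map_span, Set.image_image] at this
    exact this
  calc Fintype.card (Surj n k) = Module.finrank ℚ (Surj n k → ℚ) :=
        (Module.finrank_fintype_fun_eq_card ℚ).symm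
    _ = Module.finrank ℚ (⊤ : Submodule ℚ (Surj n k → ℚ)) := (finrank_top ℚ _).symm
    _ ≤ (T.image fun a => evalSurj n k (mono a)).card := by
        rw [← hspan]
        exact finrank_span_finset_le_card _
    _ ≤ T.card := Finset.card_image_le

end

/-! ### Degree generating function of the standard monomials. -/

section

open Polynomial

theorem qNumber_add (a b : ℕ) : qNumber (a + b) = qNumber a + X ^ a * qNumber b := by
  simp [qNumber, Finset.sum_range_add, Finset.mul_sum, pow_add]

theorem qNumber_zero : qNumber 0 = 0 := by simp [qNumber]

theorem qNumber_one : qNumber 1 = 1 := by simp [qNumber]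

/-- The degree generating function of the standard monomials. -/
noncomputable def stdGenFun (k n s : ℕ) : ℤ[X] := ∑ a ∈ std k n s, X ^ (∑ i, a i)

theorem stdGenFun_zero_zero (k : ℕ) : stdGenFun k 0 0 = 1 := by simp [stdGenFun, std]

theorem stdGenFun_zero_succ (k s : ℕ) : stdGenFun k 0 (s + 1) = 0 := by simp [stdGenFun, std]

theorem stdGenFun_succ_eq_sum (k n s : ℕ) : stdGenFun k (n + 1) s =
    ∑ i ∈ Finset.range k, X ^ i * stdGenFun k n (if i < s then s - 1 else s) := by
  rw [stdGenFun, std, Finset.sum_biUnion]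
  · refine Finset.sum_congr rfl fun i _ => ?_
    rw [Finset.sum_image fun a _ b _ h => Fin.cons_right_injective (α := fun _ => ℕ) i h,
      stdGenFun, Finset.mul_sum]
    refine Finset.sum_congr rfl fun a _ => ?_
    rw [Fin.sum_univ_succ, pow_add]
    simp
  · intro i _ j _ hij
    refine Finset.disjoint_left.mpr fun a ha hb => hij ?_
    obtain ⟨b, _, rfl⟩ := Finset.mem_image.mp ha
    obtain ⟨c, _, hc⟩ := Finset.mem_image.mp hb
    simpa using (congrFun hc 0).symm

/-- The truncated `s - 1` at `s = 0` is harmless, since `qNumber 0 = 0`. -/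
theorem stdGenFun_succ {k s : ℕ} (n : ℕ) (hs : s ≤ k) : stdGenFun k (n + 1) s =
    qNumber s * stdGenFun k n (s - 1) + X ^ s * qNumber (k - s) * stdGenFun k n s := by
  obtain ⟨m, rfl⟩ := Nat.exists_eq_add_of_le hs
  rw [stdGenFun_succ_eq_sum, Finset.sum_range_add, Nat.add_sub_cancel_left, qNumber, qNumber,
    Finset.sum_mul, Finset.mul_sum, Finset.sum_mul]
  congr 1
  · exact Finset.sum_congr rfl fun i hi => by rw [if_pos (Finset.mem_range.mp hi)]
  · exact Finset.sum_congr rfl fun i _ => by rw [if_neg (by omega), pow_add]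

theorem stdGenFun_eq_zero_of_lt {k n s : ℕ} (h : n < s) : stdGenFun k n s = 0 := by
  induction n generalizing s with
  | zero =>
    obtain ⟨t, rfl⟩ := Nat.exists_eq_succ_of_ne_zero (by omega : s ≠ 0)
    exact stdGenFun_zero_succ k t
  | succ n ih =>
    rw [stdGenFun_succ_eq_sum]
    refine Finset.sum_eq_zero fun i _ => ?_
    rw [ih (by split_ifs <;> omega), mul_zero]

/-- The recursion `stdGenFun_succ` fixes `k` and lowers `s`, whereas the Stirling recursion lowers
`k`. This identity trades one for the other and so reaches the diagonal recursion
`stdGenFun_self_succ`. -/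
theorem stdGenFun_eq_add {k s : ℕ} (n : ℕ) (hs : s ≤ k) : stdGenFun (k + 1) n s =
    stdGenFun (k + 1) n (s + 1) + X ^ (n - s) * stdGenFun k n s := by
  induction n generalizing s with
  | zero =>
    cases s with
    | zero => simp [stdGenFun_zero_zero, stdGenFun_zero_succ]
    | succ s => simp [stdGenFun_zero_succ]
  | succ n ih =>
    rw [stdGenFun_succ n (by omega), stdGenFun_succ n (by omega), stdGenFun_succ n hs,
      Nat.add_sub_cancel, Nat.add_sub_add_right, show k + 1 - s = 1 + (k - s) by omega,
      qNumber_add, qNumber_add s 1, qNumber_one, pow_one]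
    -- When `s > n` the exponents are truncated, but both sides vanish.
    have h1 : X ^ (n + 1 - s) * stdGenFun k n s = X * (X ^ (n - s) * stdGenFun k n s) := by
      rcases le_or_gt s n with h | h
      · rw [Nat.succ_sub h, pow_succ']
        ring
      · simp [stdGenFun_eq_zero_of_lt h]
    have h2 : qNumber s * stdGenFun (k + 1) n (s - 1) = qNumber s *
        (stdGenFun (k + 1) n s + X ^ (n + 1 - s) * stdGenFun k n (s - 1)) := by
      cases s with
      | zero => simp [qNumber_zero]
      | succ s => rw [Nat.add_sub_cancel, ih (by omega), Nat.add_sub_add_right]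
    rw [h2]
    linear_combination X ^ (s + 1) * qNumber (k - s) * ih hs - X ^ s * qNumber (k - s) * h1

theorem stdGenFun_self_succ (n k : ℕ) : stdGenFun (k + 1) (n + 1) (k + 1) =
    qNumber (k + 1) * (stdGenFun (k + 1) n (k + 1) + X ^ (n - k) * stdGenFun k n k) := by
  rw [stdGenFun_succ n le_rfl, Nat.add_sub_cancel, stdGenFun_eq_add n le_rfl, Nat.sub_self,
    qNumber_zero]
  ring

/-- `[k]!_q * Stir_q(n, k)`. -/
noncomputable def qSurj (n k : ℕ) : ℤ[X] := qFactorial k * qStirling n k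

theorem qSurj_zero_zero : qSurj 0 0 = 1 := by simp [qSurj, qFactorial, qStirling]

theorem qSurj_zero_succ (k : ℕ) : qSurj 0 (k + 1) = 0 := by simp [qSurj, qStirling]

theorem qSurj_succ_zero (n : ℕ) : qSurj (n + 1) 0 = 0 := by simp [qSurj, qStirling]

theorem qSurj_succ_succ (n k : ℕ) : qSurj (n + 1) (k + 1) =
    qNumber (k + 1) * (qSurj n k + qSurj n (k + 1)) := by
  have h : qFactorial (k + 1) = qFactorial k * qNumber (k + 1) :=
    Finset.prod_Icc_succ_top (by omega) _
  rw [qSurj, qSurj, qSurj, qStirling, h]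
  ring

theorem qSurj_eq_zero_of_lt {n k : ℕ} (h : n < k) : qSurj n k = 0 := by
  obtain ⟨k, rfl⟩ := Nat.exists_eq_succ_of_ne_zero (by omega : k ≠ 0)
  induction n generalizing k with
  | zero => exact qSurj_zero_succ k
  | succ n ih =>
    obtain ⟨k, rfl⟩ := Nat.exists_eq_succ_of_ne_zero (by omega : k ≠ 0)
    rw [Nat.succ_eq_add_one, qSurj_succ_succ, ih k (by omega), ih (k + 1) (by omega), add_zero,
      mul_zero]

theorem natDegree_qNumber_le (k : ℕ) : (qNumber (k + 1)).natDegree ≤ k :=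
  natDegree_sum_le_of_forall_le _ _ fun i hi => by
    rw [natDegree_X_pow]
    have := Finset.mem_range.mp hi
    omega

theorem reflect_finset_sum {ι : Type*} (N : ℕ) (s : Finset ι) (f : ι → ℤ[X]) :
    reflect N (∑ i ∈ s, f i) = ∑ i ∈ s, reflect N (f i) := by
  classical
  induction s using Finset.induction_on with
  | empty => simp
  | insert a s ha ih => rw [Finset.sum_insert ha, Finset.sum_insert ha, reflect_add, ih]

theorem reflect_qNumber (k : ℕ) : reflect k (qNumber (k + 1)) = qNumber (k + 1) := by
  rw [qNumber, reflect_finset_sum, ← Finset.sum_range_reflect]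
  refine Finset.sum_congr rfl fun i hi => ?_
  have := Finset.mem_range.mp hi
  rw [reflect_monomial, revAt_le (by omega)]
  congr 1
  omega

theorem reflect_add_degree {N : ℕ} (m : ℕ) {f : ℤ[X]} (hf : f.natDegree ≤ N) :
    reflect (N + m) f = reflect N f * X ^ m := by
  have h := reflect_mul f 1 hf (G := m) (by simp)
  rwa [mul_one, reflect_one] at h

/-- Reflection at a prescribed degree bound is additive, unlike `reverse`, so it can follow the
recursion `qSurj_succ_succ`. That the bound is the exact degree is settled afterwards. -/
theorem reflect_qSurj_and_natDegree_le {n k : ℕ} (h : k ≤ n) :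
    (qSurj n k).natDegree ≤ (k - 1) * (n - k) + k.choose 2 ∧
      reflect ((k - 1) * (n - k) + k.choose 2) (qSurj n k) = stdGenFun k n k := by
  induction n generalizing k with
  | zero =>
    obtain rfl : k = 0 := by omega
    simp [qSurj_zero_zero, stdGenFun_zero_zero]
  | succ n ih =>
    rcases k with _ | k
    · rw [qSurj_succ_zero, stdGenFun_succ n le_rfl]
      simp [qNumber]
    -- A common bound for both summands of the recursion: it is the inductive bound for `qSurj n (k
    -- + 1)` and, if `k ≥ 1`, exceeds that for `qSurj n k` by `n - k`, whence the factor `X ^ (n -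
    -- k)`.
    set d := k * (n - k) + k.choose 2 with hd
    have hD : (k + 1 - 1) * (n + 1 - (k + 1)) + (k + 1).choose 2 = k + d := by
      rw [Nat.choose_succ_succ' k 1, Nat.choose_one_right, Nat.add_sub_cancel,
        Nat.add_sub_add_right]
      ring
    have h1 : (qSurj n k).natDegree ≤ d ∧
        reflect d (qSurj n k) = X ^ (n - k) * stdGenFun k n k := by
      rcases k with _ | k
      · rcases n with _ | n
        · simp [hd, qSurj_zero_zero, stdGenFun_zero_zero]
        · rw [qSurj_succ_zero, stdGenFun_succ n le_rfl]
          simp [qNumber]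
      · obtain ⟨ha, hb⟩ := ih (k := k + 1) (by omega)
        have hdd : d = (k + 1 - 1) * (n - (k + 1)) + (k + 1).choose 2 + (n - (k + 1)) := by
          rw [hd, Nat.add_sub_cancel]
          ring
        rw [hdd, reflect_add_degree _ ha, hb]
        exact ⟨ha.trans (Nat.le_add_right _ _), mul_comm _ _⟩
    have h2 : (qSurj n (k + 1)).natDegree ≤ d ∧
        reflect d (qSurj n (k + 1)) = stdGenFun (k + 1) n (k + 1) := by
      rcases Nat.lt_or_ge n (k + 1) with hn | hn
      · rw [qSurj_eq_zero_of_lt hn, stdGenFun_eq_zero_of_lt hn]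
        simp
      · obtain ⟨m, rfl⟩ := Nat.exists_eq_add_of_le hn
        have hdd : d = (k + 1 - 1) * (k + 1 + m - (k + 1)) + (k + 1).choose 2 := by
          rw [hd, Nat.choose_succ_succ' k 1, Nat.choose_one_right, Nat.add_sub_cancel,
            Nat.add_sub_cancel_left, show k + 1 + m - k = m + 1 by omega]
          ring
        rw [hdd]
        exact ih hn
    have h3 : (qSurj n k + qSurj n (k + 1)).natDegree ≤ d := natDegree_add_le_of_degree_le h1.1 h2.1
    rw [hD, qSurj_succ_succ, reflect_mul _ _ (natDegree_qNumber_le k) h3, reflect_qNumber,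
      reflect_add, h1.2, h2.2, stdGenFun_self_succ]
    exact ⟨natDegree_mul_le_of_le (natDegree_qNumber_le k) h3, by ring⟩

/-- The monomial `1` is standard. A nonzero constant term after reflection forces `qSurj n k` to
attain its degree bound, so the reflection is `reverse`. -/
theorem coeff_zero_stdGenFun {k n s : ℕ} (hk : 1 ≤ k) (hs : s ≤ n) :
    0 < (stdGenFun k n s).coeff 0 := by
  have hmem : (0 : Fin n → ℕ) ∈ std k n s := by
    induction n generalizing s with
    | zero =>
      obtain rfl : s = 0 := by omega
      rw [std]
      exact Finset.mem_univ _
    | succ n ih =>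
      simp only [std, Finset.mem_biUnion, Finset.mem_range, Finset.mem_image]
      refine ⟨0, hk, 0, ih (by split_ifs <;> omega), ?_⟩
      ext i
      refine Fin.cases ?_ (fun j => ?_) i <;> simp
  rw [stdGenFun, finsetSum_coeff]
  refine Finset.sum_pos' (fun a _ => ?_) ⟨0, hmem, by simp⟩
  rw [coeff_X_pow]
  split_ifs <;> simp

theorem stdGenFun_self_eq_reverse {n k : ℕ} (hk : 1 ≤ k) (h : k ≤ n) :
    stdGenFun k n k = (qSurj n k).reverse := by
  obtain ⟨h1, h2⟩ := reflect_qSurj_and_natDegree_le h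
  have h3 := coeff_zero_stdGenFun hk h
  rw [← h2, coeff_reflect, revAt_zero] at h3
  rw [← h2, reverse, le_antisymm h1 (le_natDegree_of_ne_zero h3.ne')]

/-! ### Inversions of surjections and ordered set partitions. -/

/-- The indicator of the inversions of the ordered set partition given by the fibers of a map. -/
def invIndicator {n k : ℕ} (f : Fin n → Fin k) (i j : Fin n) : ℕ :=
  if i < j ∧ (∀ a, f a = f i → i ≤ a) ∧ f j < f i then 1 else 0

/-- The number of inversions of the ordered set partition given by the fibers of a map. -/
def invMap {n k : ℕ} (f : Fin n → Fin k) : ℕ := ∑ j, ∑ i, invIndicator f i j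

theorem invMap_comp {n k l : ℕ} (f : Fin n → Fin k) {e : Fin k → Fin l} (he : StrictMono e) :
    invMap (e ∘ f) = invMap f := by
  simp only [invMap, invIndicator, Function.comp_apply, he.injective.eq_iff, he.lt_iff_lt]

/-- Each of the `k - c` blocks to the right of `c` is nonempty and has exactly one minimum. -/
theorem card_filter_isLeast_fiber {n k : ℕ} (g : Fin n → Fin (k + 1)) (c : Fin (k + 1))
    (hg : ∀ b, c < b → b ∈ Set.range g) :
    (Finset.univ.filter fun i => (∀ a, g a = g i → i ≤ a) ∧ c < g i).card = k - c := by
  have h : (Finset.Ioi c).card = k - c := by rw [Fin.card_Ioi]; omega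
  rw [← h]
  refine Finset.card_bij (fun i _ => g i) (fun i hi => by simpa using (Finset.mem_filter.mp hi).2.2)
    (fun i hi j hj hij => ?_) fun b hb => ?_
  · exact le_antisymm ((Finset.mem_filter.mp hi).2.1 j hij.symm)
      ((Finset.mem_filter.mp hj).2.1 i hij)
  · have hb := Finset.mem_Ioi.mp hb
    obtain ⟨i, hi⟩ := hg b hb
    have hne : (Finset.univ.filter fun a => g a = b).Nonempty := ⟨i, by simpa using hi⟩
    have hm := (Finset.mem_filter.mp (Finset.min'_mem _ hne)).2
    refine ⟨_, Finset.mem_filter.mpr ⟨Finset.mem_univ _, fun a ha => ?_, ?_⟩, hm⟩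
    · exact Finset.min'_le _ _ (by simpa using ha.trans hm)
    · rwa [hm]

/-- The new letter is the largest: it is never the smaller letter of an inversion and does not
change the minimum of a nonempty block. As the larger letter it forms one inversion with the minimum
of each block to its right. -/
theorem invMap_snoc {n k : ℕ} (g : Fin n → Fin (k + 1)) (c : Fin (k + 1))
    (hg : ∀ b, c < b → b ∈ Set.range g) :
    invMap (Fin.snoc (α := fun _ => Fin (k + 1)) g c) = invMap g + (k - c) := by
  have h1 : ∀ i, (∀ a, Fin.snoc (α := fun _ => Fin (k + 1)) g c a = g i → i.castSucc ≤ a) ↔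
      ∀ a, g a = g i → i ≤ a := by
    intro i
    rw [Fin.forall_fin_succ']
    simp [Fin.le_last]
  have h2 : ∀ j, invIndicator (Fin.snoc (α := fun _ => Fin (k + 1)) g c) (Fin.last n) j = 0 :=
    fun j => if_neg fun h => absurd h.1 (not_lt.mpr (Fin.le_last j))
  have h3 : ∀ i j, invIndicator (Fin.snoc (α := fun _ => Fin (k + 1)) g c)
      (Fin.castSucc i) (Fin.castSucc j) = invIndicator g i j := by
    intro i j
    simp only [invIndicator, Fin.snoc_castSucc, h1, Fin.castSucc_lt_castSucc_iff]
  have h4 : ∀ i, invIndicator (Fin.snoc (α := fun _ => Fin (k + 1)) g c)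
      (Fin.castSucc i) (Fin.last n) =
      if (∀ a, g a = g i → i ≤ a) ∧ c < g i then 1 else 0 := by
    intro i
    simp only [invIndicator, Fin.snoc_castSucc, h1, Fin.snoc_last, Fin.castSucc_lt_last, true_and]
  rw [invMap, Fin.sum_univ_castSucc]
  simp only [Fin.sum_univ_castSucc (n := n), h2, h3, h4, add_zero]
  rw [← card_filter_isLeast_fiber g c hg, Finset.card_filter, invMap]

theorem sum_pow_sub (k : ℕ) : ∑ c : Fin (k + 1), (X : ℤ[X]) ^ (k - (c : ℕ)) = qNumber (k + 1) := by
  rw [Fin.sum_univ_eq_sum_range fun i => (X : ℤ[X]) ^ (k - i), qNumber, ← Finset.sum_range_reflect]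
  refine Finset.sum_congr rfl fun i hi => ?_
  have := Finset.mem_range.mp hi
  congr 1
  omega

/-- The generating function of the inversion numbers of surjections. -/
noncomputable def invGenFun (n k : ℕ) : ℤ[X] := ∑ f : Surj n k, X ^ invMap f.1

open Classical in
-- Delete the largest letter, lying in block `c`. Either all `k + 1` blocks survive, or block `c`
-- was a singleton and `k` blocks remain; in both cases the weight lost is `q ^ (k - c)`, and these
-- weights sum to `[k + 1]_q`.
theorem invGenFun_succ_succ (n k : ℕ) : invGenFun (n + 1) (k + 1) =
    qNumber (k + 1) * (invGenFun n k + invGenFun n (k + 1)) := by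
  have hcount : ∀ (m l : ℕ), invGenFun m l =
      ∑ f : Fin m → Fin l, if Function.Surjective f then X ^ invMap f else 0 := by
    intro m l
    rw [← Finset.sum_filter, invGenFun]
    exact (Finset.sum_subtype (Finset.univ.filter Function.Surjective) (fun f => by simp)
      fun f => X ^ invMap f).symm
  have hsurj : ∀ (c : Fin (k + 1)) (g : Fin n → Fin (k + 1)),
      Function.Surjective (Fin.snoc (α := fun _ => Fin (k + 1)) g c : Fin (n + 1) → Fin (k + 1)) ↔
        ∀ b, b ≠ c → b ∈ Set.range g := by
    intro c g
    refine forall_congr' fun b => ?_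
    rw [Fin.exists_fin_succ']
    simp only [Fin.snoc_castSucc, Fin.snoc_last, Set.mem_range]
    tauto
  have hterm : ∀ (c : Fin (k + 1)) (g : Fin n → Fin (k + 1)),
      (if Function.Surjective
          (Fin.snoc (α := fun _ => Fin (k + 1)) g c : Fin (n + 1) → Fin (k + 1)) then
        (X : ℤ[X]) ^ invMap (Fin.snoc (α := fun _ => Fin (k + 1)) g c) else 0) =
      X ^ (k - (c : ℕ)) * ((if Set.range g = {c}ᶜ then X ^ invMap g else 0) +
        if Function.Surjective g then X ^ invMap g else 0) := by
    intro c g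
    by_cases hs : Function.Surjective
        (Fin.snoc (α := fun _ => Fin (k + 1)) g c : Fin (n + 1) → Fin (k + 1))
    · have h := (hsurj c g).mp hs
      rw [if_pos hs, invMap_snoc g c fun b hb => h b hb.ne', pow_add, mul_comm]
      congr 1
      by_cases hc : c ∈ Set.range g
      · rw [if_neg (fun h' => by rw [h'] at hc; exact hc rfl), if_pos, zero_add]
        intro b
        by_cases hb : b = c
        · exact hb ▸ hc
        · exact h b hb
      · rw [if_pos, if_neg (fun h' => hc (h' c)), add_zero]
        ext b
        exact ⟨fun hb hbc => hc (hbc ▸ hb), h b⟩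
    · have h := fun h' => hs ((hsurj c g).mpr h')
      rw [if_neg hs, if_neg, if_neg, add_zero, mul_zero]
      · exact fun h' => h fun b _ => h' b
      · exact fun h' => h fun b hb => h' ▸ hb
  -- Closing the gap at `c` by the order embedding `c.succAbove` preserves inversions.
  have hmiss : ∀ c : Fin (k + 1), (∑ g : Fin n → Fin (k + 1),
      if Set.range g = {c}ᶜ then (X : ℤ[X]) ^ invMap g else 0) = invGenFun n k := by
    intro c
    rw [← Finset.sum_filter, invGenFun]
    symm
    refine Finset.sum_bij (fun f _ => c.succAbove ∘ f.1) (fun f _ => ?_) (fun f _ g _ h => ?_)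
      (fun g hg => ?_) fun f _ => ?_
    · rw [Finset.mem_filter, Set.range_comp, f.2.range_eq, Set.image_univ, Fin.range_succAbove]
      exact ⟨Finset.mem_univ _, rfl⟩
    · exact Subtype.ext (Fin.succAbove_right_injective.comp_left h)
    · have hg := (Finset.mem_filter.mp hg).2
      have hne : ∀ a, ∃ b, c.succAbove b = g a := fun a =>
        Fin.exists_succAbove_eq (by have := Set.mem_range_self (f := g) a; rw [hg] at this; exact this)
      choose f hf using hne
      refine ⟨⟨f, fun b => ?_⟩, Finset.mem_univ _, funext hf⟩
      have hb : c.succAbove b ∈ Set.range g := by rw [hg]; exact Fin.succAbove_ne c b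
      obtain ⟨a, ha⟩ := hb
      exact ⟨a, Fin.succAbove_right_injective ((hf a).trans ha)⟩
    · rw [invMap_comp _ (Fin.strictMono_succAbove c)]
  rw [hcount, ← (Fin.snocEquiv fun _ => Fin (k + 1)).sum_comp, Fintype.sum_prod_type]
  calc _ = ∑ c : Fin (k + 1), X ^ (k - (c : ℕ)) * (invGenFun n k + invGenFun n (k + 1)) := by
        refine Finset.sum_congr rfl fun c _ => ?_
        rw [← hmiss c, hcount n (k + 1), ← Finset.sum_add_distrib, Finset.mul_sum]
        exact Finset.sum_congr rfl fun g _ => hterm c g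
    _ = _ := by rw [← Finset.sum_mul, sum_pow_sub]

theorem invGenFun_eq_qSurj (n k : ℕ) : invGenFun n k = qSurj n k := by
  induction n generalizing k with
  | zero =>
    rcases k with _ | k
    · have : Unique (Surj 0 0) := ⟨⟨⟨id, Function.surjective_id⟩⟩, fun f => Subtype.ext (by
        ext i; exact i.elim0)⟩
      rw [invGenFun, Fintype.sum_unique, qSurj_zero_zero]
      simp [invMap]
    · have : IsEmpty (Surj 0 (k + 1)) := ⟨fun f => (f.2 0).choose.elim0⟩
      rw [invGenFun, Fintype.sum_empty, qSurj_zero_succ]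
  | succ n ih =>
    rcases k with _ | k
    · have : IsEmpty (Surj (n + 1) 0) := ⟨fun f => (f.1 0).elim0⟩
      rw [invGenFun, Fintype.sum_empty, qSurj_succ_zero]
    · rw [invGenFun_succ_succ, ih, ih, qSurj_succ_succ]

/-- The ordered set partition formed by the fibers of a surjection. -/
def fibers {n k : ℕ} (f : Surj n k) : OrderedSetPartition n k :=
  ⟨fun m => Finset.univ.filter fun a => f.1 a = m,
    fun m => (f.2 m).imp fun a ha => by simpa using ha,
    fun l m h => Finset.disjoint_left.mpr fun a ha hb => h (by
      simp only [Finset.mem_filter, Finset.mem_univ, true_and] at ha hb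
      exact ha.symm.trans hb),
    fun a => ⟨f.1 a, by simp⟩⟩

theorem mem_block_fibers {n k : ℕ} (f : Surj n k) (m : Fin k) (a : Fin n) :
    a ∈ (fibers f).block m ↔ f.1 a = m := by
  simp [fibers, OrderedSetPartition.block]

theorem fibers_bijective (n k : ℕ) : Function.Bijective (fibers (n := n) (k := k)) := by
  constructor
  · intro f g h
    refine Subtype.ext (funext fun a => ?_)
    have h1 := (mem_block_fibers f (f.1 a) a).mpr rfl
    rw [h, mem_block_fibers] at h1
    exact h1.symm
  · rintro ⟨B, hne, hdisj, hcov⟩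
    have hex := hcov
    choose f hf using hex
    have huniq : ∀ a m, a ∈ B m → f a = m := by
      intro a m ha
      by_contra h
      exact Finset.disjoint_left.mp (hdisj _ _ h) (hf a) ha
    refine ⟨⟨f, fun m => (hne m).imp fun a ha => huniq a m ha⟩, Subtype.ext (funext fun m => ?_)⟩
    ext a
    simp only [fibers, Finset.mem_filter, Finset.mem_univ, true_and]
    exact ⟨fun h => h ▸ hf a, huniq a m⟩

/-- Surjections and ordered set partitions correspond. -/
noncomputable def surjEquiv (n k : ℕ) : Surj n k ≃ OrderedSetPartition n k :=
  Equiv.ofBijective _ (fibers_bijective n k)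

theorem inv_surjEquiv {n k : ℕ} (f : Surj n k) : (surjEquiv n k f).inv = invMap f.1 := by
  have h : ∀ i j, (fibers f).IsInversion i j ↔
      i < j ∧ (∀ a, f.1 a = f.1 i → i ≤ a) ∧ f.1 j < f.1 i := by
    intro i j
    simp only [OrderedSetPartition.IsInversion, mem_block_fibers]
    refine and_congr_right fun _ => ⟨?_, fun h => ⟨_, _, h.2, ⟨rfl, h.1⟩, rfl⟩⟩
    rintro ⟨l, m, hlm, ⟨rfl, h⟩, rfl⟩
    exact ⟨h, hlm⟩
  change (fibers f).inv = _
  rw [OrderedSetPartition.inv, Finset.card_filter, Fintype.sum_prod_type_right, invMap]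
  refine Finset.sum_congr rfl fun j _ => Finset.sum_congr rfl fun i _ => ?_
  rw [invIndicator]
  exact if_congr (h i j) rfl rfl

theorem sum_X_pow_inv (n k : ℕ) :
    ∑ σ : OrderedSetPartition n k, (X : ℤ[X]) ^ σ.inv = qSurj n k := by
  rw [← invGenFun_eq_qSurj, invGenFun, ← (surjEquiv n k).sum_comp]
  simp only [inv_surjEquiv]

theorem coeff_qSurj (n k d : ℕ) : (qSurj n k).coeff d =
    ((Finset.univ.filter fun σ : OrderedSetPartition n k => σ.inv = d).card : ℤ) := by
  rw [← sum_X_pow_inv, finsetSum_coeff, Finset.card_filter, Nat.cast_sum]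
  refine Finset.sum_congr rfl fun σ _ => ?_
  rw [coeff_X_pow]
  split_ifs <;> simp_all

/-- The coefficients count partitions, so nothing cancels in top degree. -/
theorem natDegree_qSurj (n k : ℕ) :
    (qSurj n k).natDegree = OrderedSetPartition.maxInv n k := by
  apply le_antisymm
  · rw [← sum_X_pow_inv]
    refine natDegree_sum_le_of_forall_le _ _ fun σ _ => ?_
    rw [natDegree_X_pow]
    exact σ.inv_le_maxInv
  · refine Finset.sup_le fun σ _ => le_natDegree_of_ne_zero ?_
    rw [coeff_qSurj, Nat.cast_ne_zero, Finset.card_ne_zero]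
    exact ⟨σ, by simp⟩

theorem coinvGenFun_eq_reverse (n k : ℕ) : coinvGenFun n k = (qSurj n k).reverse := by
  rw [reverse, natDegree_qSurj, ← sum_X_pow_inv, reflect_finset_sum, coinvGenFun]
  refine Finset.sum_congr rfl fun σ _ => ?_
  rw [reflect_monomial, revAt_le σ.inv_le_maxInv, OrderedSetPartition.coinv]

/-! ### Specialization at `q = 1` and Stirling numbers. -/

theorem eval_one_qNumber (k : ℕ) : (qNumber k).eval 1 = k := by
  simp [qNumber, eval_finsetSum]

theorem eval_one_qFactorial (k : ℕ) : (qFactorial k).eval 1 = (k.factorial : ℤ) := by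
  induction k with
  | zero => simp [qFactorial]
  | succ k ih =>
    rw [qFactorial] at ih ⊢
    rw [Finset.prod_Icc_succ_top (by omega), eval_mul, ih, eval_one_qNumber, Nat.factorial_succ]
    push_cast
    ring

theorem eval_one_qStirling (n k : ℕ) : (qStirling n k).eval 1 = (n.stirlingSecond k : ℤ) := by
  induction n generalizing k with
  | zero => cases k <;> simp [qStirling]
  | succ n ih =>
    cases k with
    | zero => simp [qStirling]
    | succ k =>
      rw [qStirling, eval_add, eval_mul, eval_one_qNumber, ih, ih, Nat.stirlingSecond_succ_succ]
      push_cast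
      ring

theorem card_orderedSetPartition (n k : ℕ) :
    Fintype.card (OrderedSetPartition n k) = k.factorial * n.stirlingSecond k := by
  have h := congrArg (eval 1) (sum_X_pow_inv n k)
  rw [qSurj, eval_mul, eval_one_qFactorial, eval_one_qStirling, eval_finsetSum] at h
  simp only [eval_pow, eval_X, one_pow, Finset.sum_const, Finset.card_univ, nsmul_eq_mul,
    mul_one] at h
  exact_mod_cast h

theorem card_std (n k : ℕ) (hk : 1 ≤ k) (hkn : k ≤ n) :
    (std k n k).card = Fintype.card (OrderedSetPartition n k) := by
  have h := congrArg (eval 1)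
    ((stdGenFun_self_eq_reverse hk hkn).trans (coinvGenFun_eq_reverse n k).symm)
  rw [stdGenFun, coinvGenFun, eval_finsetSum, eval_finsetSum] at h
  simp only [eval_pow, eval_X, one_pow, Finset.sum_const, Finset.card_univ, nsmul_eq_mul,
    mul_one] at h
  exact_mod_cast h

/-- A set partition together with a numbering of its parts is an ordered set partition. -/
def ofNumbering {n k : ℕ}
    (x : Σ P : {P : Finpartition (Finset.univ : Finset (Fin n)) // P.parts.card = k},
      Fin k ≃ P.1.parts) : OrderedSetPartition n k :=
  ⟨fun m => (x.2 m).1, fun m => x.1.1.nonempty_of_mem_parts (x.2 m).2,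
    fun l m h => x.1.1.disjoint (x.2 l).2 (x.2 m).2 fun h' => h (x.2.injective (Subtype.ext h')),
    fun a => by
      obtain ⟨t, ht, ha⟩ := x.1.1.exists_mem (Finset.mem_univ a)
      obtain ⟨m, hm⟩ := x.2.surjective ⟨t, ht⟩
      exact ⟨m, by simpa only [hm] using ha⟩⟩

theorem ofNumbering_bijective (n k : ℕ) :
    Function.Bijective (ofNumbering (n := n) (k := k)) := by
  constructor
  · rintro ⟨⟨P, hP⟩, e⟩ ⟨⟨Q, hQ⟩, e'⟩ h
    have hB : ∀ m, (e m).1 = (e' m).1 := fun m => congrFun (congrArg Subtype.val h) m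
    obtain rfl : P = Q := by
      refine Finpartition.ext (Finset.ext fun t => ⟨fun ht => ?_, fun ht => ?_⟩)
      · obtain ⟨m, hm⟩ := e.surjective ⟨t, ht⟩
        have := (e' m).2
        rwa [← hB, hm] at this
      · obtain ⟨m, hm⟩ := e'.surjective ⟨t, ht⟩
        have := (e m).2
        rwa [hB, hm] at this
    obtain rfl : e = e' := Equiv.ext fun m => Subtype.ext (hB m)
    rfl
  · rintro ⟨B, hne, hdisj, hcov⟩
    have hinj : Function.Injective B := by
      intro l m h
      by_contra hlm
      obtain ⟨a, ha⟩ := hne l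
      exact Finset.disjoint_left.mp (hdisj l m hlm) ha (h ▸ ha)
    let P : Finpartition (Finset.univ : Finset (Fin n)) :=
      Finpartition.ofExistsUnique (Finset.univ.image B) (fun _ _ => Finset.subset_univ _)
        (fun a _ => by
          obtain ⟨m, hm⟩ := hcov a
          refine ⟨B m, ⟨Finset.mem_image_of_mem _ (Finset.mem_univ _), hm⟩, ?_⟩
          rintro t ⟨ht, ha⟩
          obtain ⟨l, -, rfl⟩ := Finset.mem_image.mp ht
          by_contra hlm
          exact Finset.disjoint_left.mp (hdisj l m fun h => hlm (h ▸ rfl)) ha hm)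
        (fun h => by
          obtain ⟨m, -, hm⟩ := Finset.mem_image.mp h
          exact (hne m).ne_empty hm)
    have hparts : P.parts = Finset.univ.image B := rfl
    refine ⟨⟨⟨P, by rw [hparts, Finset.card_image_of_injective _ hinj]; simp⟩,
      Equiv.ofBijective (fun m => ⟨B m, by rw [hparts]; simp⟩)
        ⟨fun l m h => hinj (congrArg Subtype.val h), fun t => ?_⟩⟩, rfl⟩
    have ht : t.1 ∈ Finset.univ.image B := t.2
    obtain ⟨m, -, hm⟩ := Finset.mem_image.mp ht
    exact ⟨m, Subtype.ext hm⟩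

/-- Each set partition into `k` parts has `k!` numberings; compare with `card_orderedSetPartition`
and cancel `k!`. -/
theorem stirlingSecond_eq_card_finpartition (n k : ℕ) : n.stirlingSecond k =
    Nat.card {P : Finpartition (Finset.univ : Finset (Fin n)) // P.parts.card = k} := by
  classical
  have h := Nat.card_congr (Equiv.ofBijective _ (ofNumbering_bijective n k))
  rw [Nat.card_sigma, Nat.card_eq_fintype_card, card_orderedSetPartition] at h
  have hP : ∀ P : {P : Finpartition (Finset.univ : Finset (Fin n)) // P.parts.card = k},
      Nat.card (Fin k ≃ P.1.parts) = k.factorial := by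
    intro P
    have e : Fin k ≃ P.1.parts := Fintype.equivOfCardEq (by simp [P.2])
    rw [Nat.card_eq_fintype_card, Fintype.card_equiv e, Fintype.card_fin]
  simp only [hP, Finset.sum_const, Finset.card_univ, smul_eq_mul] at h
  rw [Nat.card_eq_fintype_card]
  exact Nat.eq_of_mul_eq_mul_left k.factorial_pos (by rw [← h, mul_comm])

end

/-! ### The monomial basis and the Hilbert series. -/

section

open MvPolynomial

/-- The classes of the standard monomials in the quotient ring. -/
noncomputable def stdClass (n k : ℕ) (a : std k n k) : ringR n k :=
  Ideal.Quotient.mkₐ ℚ (idealI n k) (mono a.1)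

theorem idealI_sup_span_std {n k : ℕ} (hkn : k ≤ n) :
    (idealI n k).restrictScalars ℚ ⊔ Submodule.span ℚ (mono '' (std k n k : Set (Fin n → ℕ))) =
      ⊤ := by
  rw [← idealJ_self hkn]
  exact idealJ_sup_span_std k n k

/-- Polynomials whose classes span the quotient ring span the polynomial ring modulo the ideal. -/
theorem idealI_sup_eq_top {n k : ℕ} {M : Submodule ℚ (MvPolynomial (Fin n) ℚ)}
    (h : M.map (Ideal.Quotient.mkₐ ℚ (idealI n k)).toLinearMap = ⊤) :
    (idealI n k).restrictScalars ℚ ⊔ M = ⊤ := by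
  rw [eq_top_iff]
  rintro p -
  obtain ⟨b, hb, hbp⟩ := h.ge (Submodule.mem_top (x := Ideal.Quotient.mkₐ ℚ (idealI n k) p))
  refine Submodule.mem_sup.mpr ⟨p - b, ?_, b, hb, by ring⟩
  exact Ideal.Quotient.eq.mp hbp.symm

theorem span_stdClass {n k : ℕ} (hkn : k ≤ n) :
    Submodule.span ℚ (Set.range (stdClass n k)) = ⊤ := by
  rw [eq_top_iff]
  rintro x -
  obtain ⟨p, rfl⟩ := Ideal.Quotient.mk_surjective x
  obtain ⟨g, hg, b, hb, rfl⟩ :=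
    Submodule.mem_sup.mp ((idealI_sup_span_std hkn).ge (Submodule.mem_top (x := p)))
  rw [map_add, Ideal.Quotient.eq_zero_iff_mem.mpr hg, zero_add]
  have h := Submodule.mem_map_of_mem (f := (Ideal.Quotient.mkₐ ℚ (idealI n k)).toLinearMap) hb
  rw [Submodule.map_span, Set.image_image, Set.image_eq_range] at h
  exact h

theorem finite_ringR {n k : ℕ} (hkn : k ≤ n) : Module.Finite ℚ (ringR n k) :=
  ⟨Submodule.fg_def.mpr ⟨_, Set.finite_range _, span_stdClass hkn⟩⟩

theorem finrank_ringR {n k : ℕ} (hk : 1 ≤ k) (hkn : k ≤ n) :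
    Module.finrank ℚ (ringR n k) = (std k n k).card := by
  classical
  have := finite_ringR hkn
  apply le_antisymm
  · have h := finrank_range_le_card (R := ℚ) (stdClass n k)
    rwa [Set.finrank, span_stdClass hkn, finrank_top, Fintype.card_coe] at h
  -- A basis extracted from the standard classes still comes from monomials spanning modulo the
  -- ideal, so `card_surj_le_card` bounds its size below by the number of surjections.
  · obtain ⟨κ, a, ha, hspan, hli⟩ := exists_linearIndependent' ℚ (stdClass n k)
    have : Fintype κ := Fintype.ofInjective a ha
    rw [span_stdClass hkn] at hspan
    have hfr : Module.finrank ℚ (ringR n k) = Fintype.card κ := by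
      rw [← finrank_span_eq_card hli, hspan, finrank_top]
    let T : Finset (Fin n → ℕ) := Finset.univ.image fun i => (a i).1
    have hT : (idealJ n k k).restrictScalars ℚ ⊔
        Submodule.span ℚ (mono '' (T : Set (Fin n → ℕ))) = ⊤ := by
      rw [idealJ_self hkn]
      apply idealI_sup_eq_top
      rw [Submodule.map_span, Finset.coe_image, Finset.coe_univ, Set.image_univ,
        ← Set.range_comp, ← Set.range_comp]
      exact hspan
    rw [hfr, card_std n k hk hkn, ← Fintype.card_congr (surjEquiv n k)]
    exact (card_surj_le_card T hT).trans Finset.card_image_le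

theorem linearIndependent_stdClass {n k : ℕ} (hk : 1 ≤ k) (hkn : k ≤ n) :
    LinearIndependent ℚ (stdClass n k) :=
  linearIndependent_of_top_le_span_of_card_eq_finrank (span_stdClass hkn).ge
    (by rw [finrank_ringR hk hkn, Fintype.card_coe])

section Grading

attribute [local instance] MvPolynomial.gradedAlgebra

/-- Decompose a form of degree `d` as ideal element plus standard monomials and take degree `d`
components: the ideal is homogeneous, and only monomials of degree `d` survive. -/
theorem gradedPiece_eq_span {n k : ℕ} (hkn : k ≤ n) (d : ℕ) : gradedPiece n k d =
    Submodule.span ℚ (Set.range fun a : {a : std k n k // ∑ i, a.1 i = d} => stdClass n k a) := by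
  apply le_antisymm
  · rintro _ ⟨p, hp, rfl⟩
    obtain ⟨g, hg, b, hb, hgb⟩ :=
      Submodule.mem_sup.mp ((idealI_sup_span_std hkn).ge (Submodule.mem_top (x := p)))
    have hpd : homogeneousComponent d p = p := by
      rw [homogeneousComponent_of_mem hp, if_pos rfl]
    have hgd : homogeneousComponent d g ∈ idealI n k :=
      (mem_iff_homogeneousComponent_mem (idealI_isHomogeneous n k) _).mp hg d
    rw [← hpd, ← hgb, map_add, map_add]
    refine add_mem ?_ ?_
    · convert Submodule.zero_mem _
      exact Ideal.Quotient.eq_zero_iff_mem.mpr hgd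
    · clear hgb
      induction hb using Submodule.span_induction with
      | zero => simp
      | add x y _ _ hx hy => rw [map_add, map_add]; exact add_mem hx hy
      | smul c x _ hx => rw [map_smul, map_smul]; exact Submodule.smul_mem _ _ hx
      | mem x hx =>
        obtain ⟨a, ha, rfl⟩ := hx
        rw [homogeneousComponent_of_mem (mono_isHomogeneous a)]
        split_ifs with hd
        · exact Submodule.subset_span ⟨⟨⟨a, ha⟩, hd.symm⟩, rfl⟩
        · rw [map_zero]
          exact Submodule.zero_mem _
  · refine Submodule.span_le.mpr ?_
    rintro _ ⟨⟨a, rfl⟩, rfl⟩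
    exact ⟨mono a.1, mono_isHomogeneous a.1, rfl⟩

end Grading

theorem finrank_gradedPiece {n k : ℕ} (hk : 1 ≤ k) (hkn : k ≤ n) (d : ℕ) :
    (Module.finrank ℚ (gradedPiece n k d) : ℤ) = (stdGenFun k n k).coeff d := by
  have hli : LinearIndependent ℚ
      fun a : {a : std k n k // ∑ i, a.1 i = d} => stdClass n k a :=
    (linearIndependent_stdClass hk hkn).comp _ Subtype.val_injective
  rw [gradedPiece_eq_span hkn, finrank_span_eq_card hli, Fintype.card_subtype,
    Finset.card_filter, stdGenFun, Polynomial.finsetSum_coeff, Nat.cast_sum,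
    ← Finset.sum_coe_sort (std k n k)]
  refine Finset.sum_congr rfl fun a _ => ?_
  rw [Polynomial.coeff_X_pow]
  by_cases h : ∑ i, a.1 i = d
  · rw [if_pos h, if_pos h.symm, Nat.cast_one]
  · rw [if_neg h, if_neg (Ne.symm h), Nat.cast_zero]

end

end GenCoinv

theorem mainTheorem2 (n k : ℕ) (hk : 1 ≤ k) (hkn : k ≤ n) :
    (GenCoinv.hilbertSeries n k = (GenCoinv.coinvGenFun n k : PowerSeries ℤ) ∧
      GenCoinv.coinvGenFun n k =
        (GenCoinv.qFactorial k * GenCoinv.qStirling n k).reverse) ∧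
    (Module.Finite ℚ (GenCoinv.ringR n k) ∧
      Module.finrank ℚ (GenCoinv.ringR n k) = Fintype.card (GenCoinv.OrderedSetPartition n k) ∧
      Fintype.card (GenCoinv.OrderedSetPartition n k) =
        Nat.factorial k * Nat.stirlingSecond n k ∧
      Nat.stirlingSecond n k =
        Nat.card {P : Finpartition (Finset.univ : Finset (Fin n)) // P.parts.card = k}) := by
  refine ⟨⟨?_, GenCoinv.coinvGenFun_eq_reverse n k⟩, GenCoinv.finite_ringR hkn, ?_,
    GenCoinv.card_orderedSetPartition n k, GenCoinv.stirlingSecond_eq_card_finpartition n k⟩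
  · ext d
    rw [GenCoinv.hilbertSeries, PowerSeries.coeff_mk, GenCoinv.finrank_gradedPiece hk hkn,
      GenCoinv.stdGenFun_self_eq_reverse hk hkn, Polynomial.coeff_coe,
      GenCoinv.coinvGenFun_eq_reverse]
  · rw [GenCoinv.finrank_ringR hk hkn, GenCoinv.card_std n k hk hkn]
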